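/- Let $X_1,X_2,\dots$ be i.i.d. non-negative random variables whose law is non-arithmetic (not concentrated on $d\mathbb Z$ for any $d>0$). Put $S_0=0$, $S_n=X_1+\dots+X_n$, and for $t\ge 0$ let $N(t)=\max\{n\ge 0: S_n\le t\}$. Define the age $A(t)=t-S_{N(t)}$, the residual life-time $B(t)=S_{N(t)+1}-t$, and the length $C(t)=A(t)+B(t)$ of the cycle in progress at time $t$. Suppose that there are $\alpha\in(0,1)$, $t_0>0$ and a function $L$ that is slowly varying at infinity (that is, $L$ is positive and measurable on some half-line $[a,\infty)$ and $L(ct)/L(t)\to 1$ as $t\to\infty$ for every $c>0$) such that $$P(X_1>t)=\int_t^\infty s^{-\alpha-1}L(s)\,ds\qquad\text{for all } t>t_0$$ (the integrals being absolutely convergent). Then, as $t\to\infty$, $$\frac{A(t)}{C(t)}\Longrightarrow U^{1/\alpha}$$ in distribution, where $U$ is uniformly distributed on $(0,1)$. -/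

import Mathlib

open MeasureTheory ProbabilityTheory Filter Set
open scoped Topology

noncomputable section

namespace Renewal

/-- Slow variation at infinity: `L` is positive and (Borel) measurable on a half-line `[a, ∞)` with
`a > 0`, and `L (c t) / L t → 1` as `t → ∞` for every `c > 0`. -/
structure IsSlowlyVarying (L : ℝ → ℝ) : Prop where
  pos_measurable : ∃ a : ℝ, 0 < a ∧ (∀ t, a ≤ t → 0 < L t) ∧ Measurable (fun t : Ici a => L t)
  tendsto_ratio : ∀ c : ℝ, 0 < c → Tendsto (fun t : ℝ => L (c * t) / L t) atTop (𝓝 1)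

/-- A law on the line is arithmetic if it is concentrated on `dℤ` for some `d > 0`. -/
def IsArithmetic (μ : Measure ℝ) : Prop :=
  ∃ d : ℝ, 0 < d ∧ ∀ᵐ x ∂μ, ∃ k : ℤ, x = k * d

variable {Ω : Type*}

/-- The renewal epochs `S 0 = 0`, `S n = X 0 + ... + X (n - 1)`; the inter-arrival times are
numbered from `0`, so that `X i` is the `(i + 1)`-st one. -/
def epoch (X : ℕ → Ω → ℝ) (n : ℕ) (ω : Ω) : ℝ := ∑ i ∈ Finset.range n, X i ω

/-- `N t = max {n ≥ 0 : S n ≤ t}`. For `t ≥ 0` the set contains `0`, and it is almost surely finite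
for a renewal process whose inter-arrival times are not almost surely zero. -/
def count (X : ℕ → Ω → ℝ) (t : ℝ) (ω : Ω) : ℕ := sSup {n : ℕ | epoch X n ω ≤ t}

/-- The age `A t = t - S (N t)`. -/
def age (X : ℕ → Ω → ℝ) (t : ℝ) (ω : Ω) : ℝ := t - epoch X (count X t ω) ω

/-- The residual life-time `B t = S (N t + 1) - t`. -/
def residual (X : ℕ → Ω → ℝ) (t : ℝ) (ω : Ω) : ℝ := epoch X (count X t ω + 1) ω - t

/-- The length `C t = B t + A t` of the cycle in progress at time `t`. -/
def cycle (X : ℕ → Ω → ℝ) (t : ℝ) (ω : Ω) : ℝ := residual X t ω + age X t ω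

end Renewal

end

/-!
Only two features of the law `μ` of the inter-arrival times matter: its tail `F t = μ (t, ∞)` is
regularly varying of index `-α` (`tendsto_tail_ratio`), and far out it has a positive density.

Let `ν = ∑ n, law (S n)` be the renewal measure. Since `S n` is independent of the cycle length
`X n`, for `0 < u < 1` the decomposition over the cycle in progress at time `t` gives
`P (A t / C t < u) = ∫_{y ≤ t} F ((t - y) / u) dν(y)` and `1 = ∫_{y ≤ t} F (t - y) dν(y)`
(`measure_age_div_cycle_mem`, `lintegral_cycleSet_Iio`, `lintegral_cycleSet_univ`).
As `F (a / u) / F a → u ^ α` when `a → ∞`, the first integrand is close to `u ^ α` times the second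
one except on a window `[t - M, t]`. Hence the limit of `P (A t / C t < u)` is
`u ^ α = P (U ^ (1 / α) < u)` as soon as `ν [t - M, t] → 0` for every `M`
(`IsRenewalMeasure.tendsto_lintegral_tail_div`).

The latter is the renewal theorem for infinite mean, `IsRenewalMeasure.tendsto_measure_Icc`. The
function `v t = ν [t - M, t]` is bounded by `1 / F M` and satisfies `v t = ∫ v (t - x) dμ(x)` for
`t > M`. If `v` is close to its upper limit `η` along some sequence of times `t`, this mean value
property forces `v (t - x)` to be close to `η` for `μ`-almost all `x`, hence for Lebesgue-almost all
large `x` (`exists_seq_tendsto_limsup_sub`). But `∫ F (x + M) * v (t - x) dx ≤ M` by Tonelli's theorem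
(`IsRenewalMeasure.lintegral_tail_mul_le`), whereas `F` has infinite integral because `α < 1`
(`lintegral_tail_eq_top`); so `η = 0`.
-/

namespace Renewal

/-! ### Laws whose tail is the integral of a regularly varying function -/

lemma IsSlowlyVarying.eventually_pos {L : ℝ → ℝ} (hL : IsSlowlyVarying L) :
    ∀ᶠ t in atTop, 0 < L t := by
  obtain ⟨a, -, ha, -⟩ := hL.pos_measurable
  filter_upwards [eventually_ge_atTop a] with t ht using ha t ht

lemma exists_density_pos {α : ℝ} {L : ℝ → ℝ} (hL : IsSlowlyVarying L) (t₀ : ℝ) :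
    ∃ T, t₀ < T ∧ 0 < T ∧ ∀ s, T ≤ s → 0 < s ^ (-α - 1) * L s := by
  obtain ⟨a, ha⟩ := eventually_atTop.1 hL.eventually_pos
  refine ⟨max a (max (t₀ + 1) 1), ?_, ?_, fun s hs ↦ ?_⟩
  · exact lt_max_of_lt_right (lt_max_of_lt_left (by linarith))
  · exact lt_max_of_lt_right (lt_max_of_lt_right one_pos)
  · have h1 : 0 < s := lt_of_lt_of_le (lt_max_of_lt_right (lt_max_of_lt_right one_pos)) hs
    exact mul_pos (Real.rpow_pos_of_pos h1 _) (ha s ((le_max_left _ _).trans hs))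

lemma antitone_measure_Ioi (μ : Measure ℝ) : Antitone fun t : ℝ ↦ μ (Ioi t) :=
  fun _ _ h ↦ measure_mono (Ioi_subset_Ioi h)

section Tail

variable {μ : Measure ℝ} [IsProbabilityMeasure μ] {α t₀ : ℝ} {L : ℝ → ℝ}

lemma tail_pos (hL : IsSlowlyVarying L)
    (htail : ∀ t : ℝ, t₀ < t → IntegrableOn (fun s : ℝ ↦ s ^ (-α - 1) * L s) (Ioi t) volume ∧
      μ.real (Ioi t) = ∫ s in Ioi t, s ^ (-α - 1) * L s) (t : ℝ) :
    0 < μ.real (Ioi t) := by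
  obtain ⟨T, hT, -, hpos⟩ := exists_density_pos (α := α) hL t₀
  have h1 : t₀ < max T t := lt_max_of_lt_left hT
  refine lt_of_lt_of_le ?_ (measureReal_mono (Ioi_subset_Ioi (le_max_right T t)))
  rw [(htail _ h1).2, setIntegral_pos_iff_support_of_nonneg_ae _ (htail _ h1).1]
  · have : Function.support (fun s : ℝ ↦ s ^ (-α - 1) * L s) ∩ Ioi (max T t) = Ioi (max T t) :=
      inter_eq_right.2 fun s hs ↦ (hpos s ((le_max_left _ _).trans (le_of_lt hs))).ne'
    rw [this]; simp
  · filter_upwards [ae_restrict_mem measurableSet_Ioi] with s hs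
    exact (hpos s ((le_max_left _ _).trans (le_of_lt hs))).le

/-- The tail is regularly varying of index `-α`. The substitution `s ↦ c * s` writes
`μ (c * t, ∞)` as an integral over `(t, ∞)` of a function asymptotic to `c ^ (-α)` times the
density, so that no form of Karamata's theorem is needed. -/
lemma tendsto_tail_ratio (hL : IsSlowlyVarying L)
    (htail : ∀ t : ℝ, t₀ < t → IntegrableOn (fun s : ℝ ↦ s ^ (-α - 1) * L s) (Ioi t) volume ∧
      μ.real (Ioi t) = ∫ s in Ioi t, s ^ (-α - 1) * L s) {c : ℝ} (hc : 0 < c) :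
    Tendsto (fun t ↦ μ.real (Ioi (c * t)) / μ.real (Ioi t)) atTop (𝓝 (c ^ (-α))) := by
  obtain ⟨T, hT, hT0, hpos⟩ := exists_density_pos (α := α) hL t₀
  have hcα : 0 < c ^ (-α) := Real.rpow_pos_of_pos hc _
  rw [Metric.tendsto_nhds]
  intro ε hε
  have hδ : 0 < ε / c ^ (-α) / 2 := by positivity
  obtain ⟨T', hT'⟩ := eventually_atTop.1 ((Metric.tendsto_nhds.1 (hL.tendsto_ratio c hc)) _ hδ)
  filter_upwards [eventually_ge_atTop (max T T'),
    (tendsto_id.const_mul_atTop hc).eventually_gt_atTop t₀] with t ht hct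
  have htT : T ≤ t := (le_max_left _ _).trans ht
  obtain ⟨hi, he⟩ := htail t (hT.trans_le htT)
  obtain ⟨hi', he'⟩ := htail (c * t) hct
  set f : ℝ → ℝ := fun s ↦ s ^ (-α - 1) * L s with hf
  have hi'' : IntegrableOn (fun s ↦ c * f (c * s)) (Ioi t) volume :=
    ((integrableOn_Ioi_comp_mul_left_iff f t hc).2 hi').const_mul c
  have hF : μ.real (Ioi (c * t)) = ∫ s in Ioi t, c * f (c * s) := by
    rw [he', integral_const_mul, integral_comp_mul_left_Ioi f t hc, smul_eq_mul,
      mul_inv_cancel_left₀ hc.ne']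
  have hp : 0 < μ.real (Ioi t) := tail_pos hL htail t
  have key : |μ.real (Ioi (c * t)) - c ^ (-α) * μ.real (Ioi t)| ≤ ε / 2 * μ.real (Ioi t) := by
    rw [hF, he, ← integral_const_mul, ← integral_const_mul, ← integral_sub hi'' (hi.const_mul _),
      ← Real.norm_eq_abs]
    refine norm_integral_le_of_norm_le (hi.const_mul _) ?_
    filter_upwards [ae_restrict_mem measurableSet_Ioi] with s hs
    have hsT : T ≤ s := htT.trans (le_of_lt hs)
    have hs0 : 0 < s := hT0.trans_le hsT
    have hfs := hpos s hsT
    have hLs : 0 < L s := by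
      have := Real.rpow_pos_of_pos hs0 (-α - 1)
      exact (pos_iff_pos_of_mul_pos hfs).1 this
    have hr := hT' s (((le_max_right _ _).trans ht).trans (le_of_lt hs))
    rw [Real.dist_eq] at hr
    have e1 : c * f (c * s) - c ^ (-α) * f s = c ^ (-α) * f s * (L (c * s) / L s - 1) := by
      have : c ^ (-α) = c * c ^ (-α - 1) := by
        rw [Real.rpow_sub_one hc.ne']; field_simp
      simp only [hf, Real.mul_rpow hc.le hs0.le]
      rw [this]; field_simp
    rw [e1, Real.norm_eq_abs, abs_mul, abs_of_pos (mul_pos hcα hfs)]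
    calc c ^ (-α) * f s * |L (c * s) / L s - 1| ≤ c ^ (-α) * f s * (ε / c ^ (-α) / 2) := by
          gcongr
      _ = ε / 2 * f s := by field_simp
  rw [Real.dist_eq]
  have : μ.real (Ioi (c * t)) / μ.real (Ioi t) - c ^ (-α)
      = (μ.real (Ioi (c * t)) - c ^ (-α) * μ.real (Ioi t)) / μ.real (Ioi t) := by
    field_simp
  rw [this, abs_div, abs_of_pos hp, div_lt_iff₀ hp]
  have : ε / 2 * μ.real (Ioi t) < ε * μ.real (Ioi t) := by gcongr; linarith
  linarith

/-- The mean is infinite: if the tail `F` were integrable then, as `F x ≤ 2 * F (2 * x)` for large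
`x`, the substitution `x ↦ 2 * x` would give `∫_T^∞ F ≤ ∫_{2T}^∞ F` for large `T`, although `F` is
positive. -/
lemma lintegral_tail_eq_top (hα : α < 1) (hL : IsSlowlyVarying L)
    (htail : ∀ t : ℝ, t₀ < t → IntegrableOn (fun s : ℝ ↦ s ^ (-α - 1) * L s) (Ioi t) volume ∧
      μ.real (Ioi t) = ∫ s in Ioi t, s ^ (-α - 1) * L s) (T : ℝ) :
    ∫⁻ x in Ioi T, μ (Ioi x) = ⊤ := by
  by_contra hfin
  have hint : IntegrableOn (fun x ↦ μ.real (Ioi x)) (Ioi T) volume :=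
    integrable_toReal_of_lintegral_ne_top
      (antitone_measure_Ioi μ).measurable.aemeasurable hfin
  have h2 : (2 : ℝ)⁻¹ < (2 : ℝ) ^ (-α) := by
    rw [← Real.rpow_neg_one]
    exact Real.rpow_lt_rpow_of_exponent_lt (by norm_num) (by linarith)
  obtain ⟨T', hT'⟩ := eventually_atTop.1
    ((tendsto_tail_ratio hL htail (c := 2) two_pos).eventually_const_lt h2)
  set K := max (max T T') 1
  have hK : 0 < K := lt_max_of_lt_right one_pos
  have hiK : IntegrableOn (fun x ↦ μ.real (Ioi x)) (Ioi K) volume :=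
    hint.mono_set (Ioi_subset_Ioi ((le_max_left _ _).trans (le_max_left _ _)))
  have hi2K : IntegrableOn (fun x ↦ μ.real (Ioi x)) (Ioi (2 * K)) volume :=
    hiK.mono_set (Ioi_subset_Ioi (by linarith))
  have hsub : ∫ x in Ioi (2 * K), μ.real (Ioi x) = ∫ x in Ioi K, 2 * μ.real (Ioi (2 * x)) := by
    rw [integral_const_mul, integral_comp_mul_left_Ioi (fun x ↦ μ.real (Ioi x)) K two_pos,
      smul_eq_mul, mul_inv_cancel_left₀ two_ne_zero]
  have hle : ∫ x in Ioi K, μ.real (Ioi x) ≤ ∫ x in Ioi (2 * K), μ.real (Ioi x) := by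
    rw [hsub]
    refine setIntegral_mono_on hiK
      (((integrableOn_Ioi_comp_mul_left_iff (fun x ↦ μ.real (Ioi x)) K two_pos).2 hi2K).const_mul 2)
      measurableSet_Ioi fun x hx ↦ ?_
    have := hT' x (((le_max_right _ _).trans (le_max_left _ _)).trans (le_of_lt hx))
    rw [lt_div_iff₀ (tail_pos hL htail x)] at this
    linarith
  have hsplit : ∫ x in Ioi K, μ.real (Ioi x)
      = (∫ x in Ioc K (2 * K), μ.real (Ioi x)) + ∫ x in Ioi (2 * K), μ.real (Ioi x) := by
    rw [← setIntegral_union Ioc_disjoint_Ioi_same measurableSet_Ioi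
      (hiK.mono_set Ioc_subset_Ioi_self) hi2K, Ioc_union_Ioi_eq_Ioi (by linarith)]
  have hpos : 0 < ∫ x in Ioc K (2 * K), μ.real (Ioi x) := by
    rw [setIntegral_pos_iff_support_of_nonneg_ae (ae_of_all _ fun x ↦ measureReal_nonneg)
      (hiK.mono_set Ioc_subset_Ioi_self)]
    have : Function.support (fun x ↦ μ.real (Ioi x)) = univ :=
      eq_univ_of_forall fun x ↦ (tail_pos hL htail x).ne'
    rw [this]; simp; linarith
  linarith

/-- Far enough to the right the law has a positive density, so that Lebesgue measure is absolutely
continuous with respect to it. -/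
lemma exists_restrict_Ioi_absolutelyContinuous (hL : IsSlowlyVarying L)
    (htail : ∀ t : ℝ, t₀ < t → IntegrableOn (fun s : ℝ ↦ s ^ (-α - 1) * L s) (Ioi t) volume ∧
      μ.real (Ioi t) = ∫ s in Ioi t, s ^ (-α - 1) * L s) :
    ∃ T, 0 ≤ T ∧ volume.restrict (Ioi T) ≪ μ := by
  obtain ⟨T, hT, hT0, hpos⟩ := exists_density_pos (α := α) hL t₀
  refine ⟨T, hT0.le, ?_⟩
  set f : ℝ → ℝ := fun s ↦ s ^ (-α - 1) * L s
  have hi := (htail T hT).1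
  have hl : ∀ t, T ≤ t → ∫⁻ s in Ioi t, ENNReal.ofReal (f s) = μ (Ioi t) := fun t ht ↦ by
    have h := htail t (hT.trans_le ht)
    rw [← ofReal_integral_eq_lintegral_ofReal h.1, ← h.2, ofReal_measureReal]
    filter_upwards [ae_restrict_mem measurableSet_Ioi] with s hs
    exact (hpos s (ht.trans (le_of_lt hs))).le
  have heq : μ.restrict (Ioi T) =
      (volume.restrict (Ioi T)).withDensity fun s ↦ ENNReal.ofReal (f s) := by
    refine ext_of_generate_finite _ (borel_eq_generateFrom_Ioi ℝ ▸ BorelSpace.measurable_eq)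
      isPiSystem_Ioi ?_ ?_
    · rintro _ ⟨t, rfl⟩
      rw [withDensity_apply _ measurableSet_Ioi, Measure.restrict_restrict measurableSet_Ioi,
        Measure.restrict_apply measurableSet_Ioi, Ioi_inter_Ioi, hl _ le_sup_right]
    · rw [withDensity_apply _ MeasurableSet.univ, Measure.restrict_univ, hl T le_rfl,
        Measure.restrict_apply_univ]
  refine (withDensity_absolutelyContinuous' (f := fun s ↦ ENNReal.ofReal (f s))
    hi.aemeasurable.ennreal_ofReal ?_).trans
    (heq ▸ Measure.restrict_le_self.absolutelyContinuous)
  filter_upwards [ae_restrict_mem measurableSet_Ioi] with s hs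
  simpa using hpos s (le_of_lt hs)

end Tail

/-! ### Renewal measures of infinite mean -/

/-- The properties used of the renewal measure `ν = ∑ n, law (S n)` of a law `μ` on `[0, ∞)`. The
first says that the events `S n ≤ t < S (n + 1)` have total probability at most one, the second is
the renewal equation `ν = δ₀ + ν ∗ μ`, evaluated on sets that do not contain the origin. -/
structure IsRenewalMeasure (μ ν : Measure ℝ) : Prop where
  lintegral_tail_le_one : ∀ t : ℝ, ∫⁻ y in Iic t, μ (Ioi (t - y)) ∂ν ≤ 1
  apply_eq_lintegral : ∀ B : Set ℝ, MeasurableSet B → (0 : ℝ) ∉ B →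
    ν B = ∫⁻ x, ν {y | y + x ∈ B} ∂μ

variable {μ ν : Measure ℝ}

/-- A renewal in `[t - M, t]` is the last one before time `t` with probability at least
`μ (M, ∞)`, which bounds the number of renewals in this window. -/
lemma IsRenewalMeasure.measure_Icc_le (h : IsRenewalMeasure μ ν) (M t : ℝ) :
    μ (Ioi M) * ν (Icc (t - M) t) ≤ 1 := by
  refine le_trans ?_ (h.lintegral_tail_le_one t)
  calc μ (Ioi M) * ν (Icc (t - M) t) = ∫⁻ _ in Icc (t - M) t, μ (Ioi M) ∂ν := by simp
    _ ≤ ∫⁻ y in Icc (t - M) t, μ (Ioi (t - y)) ∂ν :=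
        setLIntegral_mono ((antitone_measure_Ioi μ).measurable.comp (by fun_prop)) fun y hy ↦
          antitone_measure_Ioi μ (by linarith [hy.1])
    _ ≤ _ := lintegral_mono_set Icc_subset_Iic_self

lemma IsRenewalMeasure.measure_Icc_le_inv [IsFiniteMeasure μ] (h : IsRenewalMeasure μ ν)
    (hpos : ∀ t, 0 < μ.real (Ioi t)) (M t : ℝ) : ν (Icc (t - M) t) ≤ (μ (Ioi M))⁻¹ := by
  have h0 : μ (Ioi M) ≠ 0 := fun h0 ↦ by simpa [measureReal_def, h0] using hpos M
  rw [ENNReal.le_inv_iff_mul_le, mul_comm]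
  exact h.measure_Icc_le M t

lemma IsRenewalMeasure.measure_Icc_ne_top [IsFiniteMeasure μ] (h : IsRenewalMeasure μ ν)
    (hpos : ∀ t, 0 < μ.real (Ioi t)) (M t : ℝ) : ν (Icc (t - M) t) ≠ ⊤ := by
  have h0 : μ (Ioi M) ≠ 0 := fun h0 ↦ by simpa [measureReal_def, h0] using hpos M
  exact ne_top_of_le_ne_top (ENNReal.inv_ne_top.2 h0) (h.measure_Icc_le_inv hpos M t)

lemma measurable_measure_Icc_sub [SFinite ν] (M : ℝ) :
    Measurable fun t : ℝ ↦ ν (Icc (t - M) t) := by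
  have hE : MeasurableSet {p : ℝ × ℝ | p.1 - M ≤ p.2 ∧ p.2 ≤ p.1} := by
    measurability
  exact measurable_measure_prodMk_left hE

/-- Tonelli: each renewal epoch `y` is seen by the windows `[t - x - M, t - x]` for a set of `x` of
length `M`, on which the tail at `x + M` is at most the tail at `t - y`. -/
lemma IsRenewalMeasure.lintegral_tail_mul_le [SFinite ν] (h : IsRenewalMeasure μ ν)
    {T : ℝ} (hT : 0 ≤ T) (M t : ℝ) :
    ∫⁻ x in Ioi T, μ (Ioi (x + M)) * ν (Icc (t - x - M) (t - x)) ≤ ENNReal.ofReal M := by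
  have hm := (antitone_measure_Ioi μ).measurable
  have hE : MeasurableSet {p : ℝ × ℝ | t - p.1 - M ≤ p.2 ∧ p.2 ≤ t - p.1} := by
    measurability
  calc ∫⁻ x in Ioi T, μ (Ioi (x + M)) * ν (Icc (t - x - M) (t - x))
      = ∫⁻ x in Ioi T, ∫⁻ y, {p : ℝ × ℝ | t - p.1 - M ≤ p.2 ∧ p.2 ≤ t - p.1}.indicator
          (fun p ↦ μ (Ioi (p.1 + M))) (x, y) ∂ν := by
        refine lintegral_congr fun x ↦ ?_
        rw [← setLIntegral_const, ← lintegral_indicator measurableSet_Icc]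
        rfl
    _ = ∫⁻ y, (∫⁻ x in Ioi T, {p : ℝ × ℝ | t - p.1 - M ≤ p.2 ∧ p.2 ≤ t - p.1}.indicator
          (fun p ↦ μ (Ioi (p.1 + M))) (x, y)) ∂ν :=
        lintegral_lintegral_swap (f := fun x y ↦
          {p : ℝ × ℝ | t - p.1 - M ≤ p.2 ∧ p.2 ≤ t - p.1}.indicator
            (fun p ↦ μ (Ioi (p.1 + M))) (x, y))
          ((hm.comp (by fun_prop : Measurable fun p : ℝ × ℝ ↦ p.1 + M)).indicator hE).aemeasurable
    _ ≤ ∫⁻ y, (Iic t).indicator (fun y ↦ μ (Ioi (t - y)) * ENNReal.ofReal M) y ∂ν := by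
        refine lintegral_mono fun y ↦ ?_
        by_cases hy : y ≤ t
        · rw [indicator_of_mem (by exact hy)]
          calc ∫⁻ x in Ioi T, {p : ℝ × ℝ | t - p.1 - M ≤ p.2 ∧ p.2 ≤ t - p.1}.indicator
                (fun p ↦ μ (Ioi (p.1 + M))) (x, y)
              ≤ ∫⁻ x in Ioi T, (Icc (t - y - M) (t - y)).indicator
                (fun _ ↦ μ (Ioi (t - y))) x := by
                refine lintegral_mono fun x ↦ ?_
                by_cases hx : x ∈ Icc (t - y - M) (t - y)
                · rw [indicator_of_mem hx]
                  exact (indicator_le_self' (fun _ _ ↦ zero_le) _).trans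
                    (antitone_measure_Ioi μ (by linarith [hx.1]))
                · rw [indicator_of_notMem hx, indicator_of_notMem]
                  rintro ⟨h1, h2⟩
                  exact hx ⟨by dsimp at h1; linarith, by dsimp at h2; linarith⟩
            _ ≤ ∫⁻ x, (Icc (t - y - M) (t - y)).indicator (fun _ ↦ μ (Ioi (t - y))) x :=
                setLIntegral_le_lintegral _ _
            _ = _ := by
                rw [lintegral_indicator measurableSet_Icc, setLIntegral_const, Real.volume_Icc]
                congr 2; ring
        · rw [indicator_of_notMem (by exact hy)]
          refine le_of_eq (setLIntegral_eq_zero measurableSet_Ioi fun x hx ↦ ?_)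
          rw [indicator_of_notMem]; · rfl
          rintro ⟨-, h2⟩
          have : T < x := hx
          dsimp at h2
          linarith
    _ = (∫⁻ y in Iic t, μ (Ioi (t - y)) ∂ν) * ENNReal.ofReal M := by
        rw [lintegral_indicator measurableSet_Iic, lintegral_mul_const]
        exact hm.comp (by fun_prop)
    _ ≤ ENNReal.ofReal M := by
        simpa using mul_le_mul_left (h.lintegral_tail_le_one t) (ENNReal.ofReal M)

/-- If a bounded function `v` satisfies `v t = ∫ v (t - x) dμ(x)` for large `t` and `v (t k)` tends
to the upper limit of `v`, then so does `v (t k - x)` for `μ`-almost all `x`, along a subsequence.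
Indeed no value of `v` far out exceeds the upper limit by much, so that almost all of them have to
be close to it when their average is. -/
lemma exists_seq_tendsto_limsup_sub [IsProbabilityMeasure μ] {v : ℝ → ℝ} (hv : Measurable v)
    {C : ℝ} (h0 : ∀ t, 0 ≤ v t) (hC : ∀ t, v t ≤ C)
    (heq : ∀ᶠ t in atTop, v t = ∫ x, v (t - x) ∂μ) :
    ∃ τ : ℕ → ℝ, Tendsto τ atTop atTop ∧
      ∀ᵐ x ∂μ, Tendsto (fun k ↦ v (τ k - x)) atTop (𝓝 (limsup v atTop)) := by
  have hbdd : IsBoundedUnder (· ≤ ·) atTop v := isBoundedUnder_of ⟨C, hC⟩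
  have hcob : IsCoboundedUnder (· ≤ ·) atTop v := (isBoundedUnder_of ⟨0, h0⟩).isCoboundedUnder_le
  obtain ⟨τ, hτ, hτ'⟩ := exists_seq_tendsto_limsup hcob hbdd
  set η := limsup v atTop with hη
  have hint : ∀ k, Integrable (fun x ↦ v (τ k - x)) μ := fun k ↦
    Integrable.of_bound (hv.comp (by fun_prop)).aestronglyMeasurable C (ae_of_all _ fun x ↦ by
      rw [Real.norm_eq_abs, abs_of_nonneg (h0 _)]; exact hC _)
  have hη0 : 0 ≤ η := ge_of_tendsto' hτ fun k ↦ h0 _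
  -- the part of `v (τ k - x)` above the upper limit disappears
  have hplus : Tendsto (fun k ↦ ∫ x, max (v (τ k - x) - η) 0 ∂μ) atTop (𝓝 0) := by
    have := tendsto_integral_of_dominated_convergence (μ := μ)
      (F := fun k x ↦ max (v (τ k - x) - η) 0) (f := fun _ ↦ 0) (fun _ ↦ C)
      (fun k ↦ ((hint k).1.sub aestronglyMeasurable_const).sup aestronglyMeasurable_const)
      (integrable_const _)
      (fun k ↦ ae_of_all _ fun x ↦ by
        rw [Real.norm_eq_abs, abs_of_nonneg (le_max_right _ _)]
        exact max_le (by linarith [hC (τ k - x)]) ((h0 0).trans (hC 0))) ?_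
    · simpa using this
    · refine ae_of_all _ fun x ↦ ?_
      rw [Metric.tendsto_nhds]
      intro ε hε
      have h1 : ∀ᶠ t in atTop, v t < η + ε :=
        eventually_lt_of_limsup_lt (by linarith) hbdd
      filter_upwards [(tendsto_atTop_add_const_right _ (-x) hτ').eventually h1] with k hk
      rw [Real.dist_eq, sub_zero, abs_of_nonneg (le_max_right _ _)]
      exact max_lt (by rw [sub_eq_add_neg (τ k) x]; linarith) hε
  have hmean : Tendsto (fun k ↦ ∫ x, v (τ k - x) ∂μ) atTop (𝓝 η) :=
    hτ.congr' (by filter_upwards [hτ'.eventually heq] with k hk using hk)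
  have habs : Tendsto (fun k ↦ ∫ x, ‖v (τ k - x) - η‖ ∂μ) atTop (𝓝 0) := by
    have h1 : ∀ k, ∫ x, ‖v (τ k - x) - η‖ ∂μ
        = (η - ∫ x, v (τ k - x) ∂μ) + 2 * ∫ x, max (v (τ k - x) - η) 0 ∂μ := fun k ↦ by
      have hi1 : Integrable (fun x ↦ max (v (τ k - x) - η) 0) μ :=
        ((hint k).sub (integrable_const η)).sup (integrable_const 0)
      have e : (fun x ↦ ‖v (τ k - x) - η‖)
          = fun x ↦ (η - v (τ k - x)) + 2 * max (v (τ k - x) - η) 0 := by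
        funext x
        rw [Real.norm_eq_abs]
        rcases le_total (v (τ k - x) - η) 0 with h | h
        · rw [abs_of_nonpos h, max_eq_right h]; ring
        · rw [abs_of_nonneg h, max_eq_left h]; ring
      have hi2 : Integrable (fun x ↦ η - v (τ k - x)) μ := (integrable_const η).sub (hint k)
      rw [e, integral_add hi2 (hi1.const_mul 2), integral_sub (integrable_const η) (hint k),
        integral_const_mul]
      simp
    simp_rw [h1]
    simpa using ((tendsto_const_nhds (x := η)).sub hmean).add (hplus.const_mul 2)
  have hLp : Tendsto (fun k ↦ eLpNorm ((fun x ↦ v (τ k - x)) - fun _ ↦ η) 1 μ) atTop (𝓝 0) := by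
    have h2 := (ENNReal.continuous_ofReal.tendsto 0).comp habs
    rw [ENNReal.ofReal_zero] at h2
    refine h2.congr fun k ↦ ?_
    rw [eLpNorm_one_eq_lintegral_enorm]
    exact ofReal_integral_norm_eq_lintegral_enorm ((hint k).sub (integrable_const η))
  obtain ⟨φ, hφ, hae⟩ := (tendstoInMeasure_of_tendsto_eLpNorm one_ne_zero (fun k ↦ (hint k).1)
    aestronglyMeasurable_const hLp).exists_seq_tendsto_ae
  exact ⟨τ ∘ φ, hτ'.comp hφ.tendsto_atTop, hae⟩

/-- The renewal theorem in the infinite mean case, for a law that dominates Lebesgue measure far out: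
the expected number of renewals in a window of fixed length that moves to infinity tends to zero. A
positive upper limit `η` would be attained simultaneously by almost all windows on the left of a
suitable one, so that `∫ F (x + M) * η dx` would be bounded, against the divergence of the
integral of the tail `F`. -/
theorem IsRenewalMeasure.tendsto_measure_Icc [IsProbabilityMeasure μ] [SFinite ν]
    (h : IsRenewalMeasure μ ν) (hpos : ∀ t, 0 < μ.real (Ioi t))
    (hinf : ∀ T : ℝ, ∫⁻ x in Ioi T, μ (Ioi x) = ⊤)
    (hac : ∃ T, 0 ≤ T ∧ volume.restrict (Ioi T) ≪ μ) (M : ℝ) :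
    Tendsto (fun t : ℝ ↦ ν.real (Icc (t - M) t)) atTop (𝓝 0) := by
  set v : ℝ → ℝ := fun t ↦ ν.real (Icc (t - M) t) with hv
  have hmeas : Measurable v := (measurable_measure_Icc_sub M).ennreal_toReal
  have h0 : ∀ t, 0 ≤ v t := fun t ↦ measureReal_nonneg
  have hM0 : μ (Ioi M) ≠ 0 := fun h0 ↦ by simpa [measureReal_def, h0] using hpos M
  have hC : ∀ t, v t ≤ ((μ (Ioi M))⁻¹).toReal := fun t ↦
    ENNReal.toReal_mono (ENNReal.inv_ne_top.2 hM0) (h.measure_Icc_le_inv hpos M t)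
  have hofReal : ∀ t, ENNReal.ofReal (v t) = ν (Icc (t - M) t) := fun t ↦
    ENNReal.ofReal_toReal (h.measure_Icc_ne_top hpos M t)
  have heq : ∀ᶠ t in atTop, v t = ∫ x, v (t - x) ∂μ := by
    filter_upwards [eventually_gt_atTop M] with t ht
    have hset : ∀ x, {y | y + x ∈ Icc (t - M) t} = Icc (t - x - M) (t - x) := fun x ↦ by
      ext y
      simp only [mem_ofPred_eq, mem_Icc]
      constructor <;> rintro ⟨h1, h2⟩ <;> constructor <;> linarith
    have h1 := h.apply_eq_lintegral (Icc (t - M) t) measurableSet_Icc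
      (fun h ↦ by linarith [h.1])
    simp_rw [hset] at h1
    have hm : Measurable fun x : ℝ ↦ ν (Icc (t - x - M) (t - x)) :=
      (measurable_measure_Icc_sub M).comp (by fun_prop : Measurable fun x : ℝ ↦ t - x)
    simp only [hv, measureReal_def]
    rw [h1, integral_toReal hm.aemeasurable
      (ae_of_all _ fun x ↦ (h.measure_Icc_ne_top hpos M _).lt_top)]
  obtain ⟨τ, hτ, hae⟩ := exists_seq_tendsto_limsup_sub hmeas h0 hC heq
  set η := limsup v atTop with hη
  obtain ⟨T, hT, hac⟩ := hac
  have hbdd : IsBoundedUnder (· ≤ ·) atTop v := isBoundedUnder_of ⟨_, hC⟩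
  have key : (∫⁻ x in Ioi T, μ (Ioi (x + M))) * ENNReal.ofReal η ≤ ENNReal.ofReal M := by
    have hmF : Measurable fun x ↦ μ (Ioi (x + M)) :=
      (antitone_measure_Ioi μ).measurable.comp (by fun_prop : Measurable fun x : ℝ ↦ x + M)
    have hmR : ∀ k, Measurable fun x ↦ ENNReal.ofReal (v (τ k - x)) := fun k ↦
      (hmeas.comp (by fun_prop : Measurable fun x : ℝ ↦ τ k - x)).ennreal_ofReal
    rw [← lintegral_mul_const _ hmF]
    calc ∫⁻ x in Ioi T, μ (Ioi (x + M)) * ENNReal.ofReal η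
        = ∫⁻ x in Ioi T, liminf (fun k ↦ μ (Ioi (x + M)) * ENNReal.ofReal (v (τ k - x))) atTop := by
          refine lintegral_congr_ae ?_
          filter_upwards [hac.ae_le hae] with x hx
          exact (ENNReal.Tendsto.const_mul (ENNReal.tendsto_ofReal hx)
            (Or.inr (measure_ne_top _ _))).liminf_eq.symm
      _ ≤ liminf (fun k ↦ ∫⁻ x in Ioi T, μ (Ioi (x + M)) * ENNReal.ofReal (v (τ k - x))) atTop :=
          lintegral_liminf_le fun k ↦ hmF.mul (hmR k)
      _ ≤ ENNReal.ofReal M := by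
          refine liminf_le_of_le (by isBoundedDefault) fun b hb ↦ ?_
          obtain ⟨k, hk⟩ := hb.exists
          refine hk.trans ?_
          simp_rw [hofReal]
          exact h.lintegral_tail_mul_le hT M (τ k)
  have hshift : ∫⁻ x in Ioi T, μ (Ioi (x + M)) = ⊤ := by
    have h1 := (measurePreserving_add_right volume M).setLIntegral_comp_preimage
      (s := Ioi (T + M)) measurableSet_Ioi (antitone_measure_Ioi μ).measurable
    rw [hinf] at h1
    have : (fun x ↦ x + M) ⁻¹' Ioi (T + M) = Ioi T := by ext; simp
    rwa [this] at h1
  have hη0 : η ≤ 0 := by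
    by_contra hη0
    rw [hshift, ENNReal.top_mul (by simpa using hη0)] at key
    exact ENNReal.ofReal_ne_top (top_le_iff.1 key)
  refine tendsto_order.2 ⟨fun a ha ↦ Eventually.of_forall fun t ↦ ha.trans_le (h0 t),
    fun a ha ↦ ?_⟩
  exact eventually_lt_of_limsup_lt (hη0.trans_lt ha) hbdd

/-- Where `t - y` is large the tail at `(t - y) / u` is close to `u ^ α` times the tail at `t - y`,
and the renewals with `t - y` bounded do not contribute in the limit. -/
lemma IsRenewalMeasure.tendsto_lintegral_tail_div [IsProbabilityMeasure μ]
    (h : IsRenewalMeasure μ ν) (hpos : ∀ t, 0 < μ.real (Ioi t))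
    (hone : ∀ t, 0 ≤ t → ∫⁻ y in Iic t, μ (Ioi (t - y)) ∂ν = 1)
    (hvan : ∀ M, Tendsto (fun t : ℝ ↦ ν.real (Icc (t - M) t)) atTop (𝓝 0))
    {α u : ℝ} (hu : u ∈ Ioo (0 : ℝ) 1) (hα : 0 ≤ α)
    (hreg : Tendsto (fun t ↦ μ.real (Ioi (u⁻¹ * t)) / μ.real (Ioi t)) atTop (𝓝 (u ^ α))) :
    Tendsto (fun t ↦ (∫⁻ y in Iic t, μ (Ioi ((t - y) / u)) ∂ν).toReal) atTop (𝓝 (u ^ α)) := by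
  have huα : u ^ α ≤ 1 := Real.rpow_le_one hu.1.le hu.2.le hα
  have huα0 : 0 < u ^ α := Real.rpow_pos_of_pos hu.1 _
  have hm := (antitone_measure_Ioi μ).measurable
  have hm1 : ∀ t, Measurable fun y ↦ μ (Ioi (t - y)) := fun t ↦ hm.comp (by fun_prop)
  have hm2 : ∀ t, Measurable fun y ↦ μ (Ioi ((t - y) / u)) := fun t ↦ hm.comp (by fun_prop)
  rw [Metric.tendsto_nhds]
  intro ε hε
  obtain ⟨M', hM'⟩ := eventually_atTop.1 ((Metric.tendsto_nhds.1 hreg) (ε / 2) (by linarith))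
  set M := max M' 0
  filter_upwards [eventually_ge_atTop 0, (hvan M).eventually_lt_const (half_pos hε)] with t ht hv
  have hle : ∀ y ≤ t, μ (Ioi ((t - y) / u)) ≤ μ (Ioi (t - y)) := fun y hy ↦
    antitone_measure_Ioi μ (le_div_self (by linarith) hu.1 hu.2.le)
  have hi1 : IntegrableOn (fun y ↦ μ.real (Ioi (t - y))) (Iic t) ν :=
    integrable_toReal_of_lintegral_ne_top (hm1 t).aemeasurable (by simp [hone t ht])
  have hi2 : IntegrableOn (fun y ↦ μ.real (Ioi ((t - y) / u))) (Iic t) ν := by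
    refine integrable_toReal_of_lintegral_ne_top (hm2 t).aemeasurable ?_
    refine ne_top_of_le_ne_top ENNReal.one_ne_top ((setLIntegral_mono (hm1 t) ?_).trans
      (hone t ht).le)
    exact fun y hy ↦ hle y hy
  have hi3 : Integrable ((Icc (t - M) t).indicator fun _ ↦ (1 : ℝ)) (ν.restrict (Iic t)) :=
    ((integrable_indicator_iff measurableSet_Icc).2
      (integrableOn_const (h.measure_Icc_ne_top hpos M t))).mono_measure Measure.restrict_le_self
  have e1 : (∫⁻ y in Iic t, μ (Ioi ((t - y) / u)) ∂ν).toReal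
      = ∫ y in Iic t, μ.real (Ioi ((t - y) / u)) ∂ν :=
    (integral_toReal (hm2 t).aemeasurable (ae_of_all _ fun _ ↦ measure_lt_top _ _)).symm
  have e2 : ∫ y in Iic t, μ.real (Ioi (t - y)) ∂ν = 1 := by
    have := integral_toReal (μ := ν.restrict (Iic t)) (hm1 t).aemeasurable
      (ae_of_all _ fun _ ↦ measure_lt_top _ _)
    simpa [measureReal_def, hone t ht] using this
  have e3 : u ^ α = ∫ y in Iic t, u ^ α * μ.real (Ioi (t - y)) ∂ν := by
    rw [integral_const_mul, e2, mul_one]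
  rw [dist_eq_norm, e1, e3, ← integral_sub hi2 (hi1.const_mul _)]
  have hbound : ‖∫ y in Iic t, (μ.real (Ioi ((t - y) / u)) - u ^ α * μ.real (Ioi (t - y))) ∂ν‖
      ≤ ∫ y in Iic t, (ε / 2 * μ.real (Ioi (t - y))
        + (Icc (t - M) t).indicator (fun _ ↦ 1) y) ∂ν := by
    refine norm_integral_le_of_norm_le ((hi1.const_mul _).add hi3) ?_
    filter_upwards [ae_restrict_mem measurableSet_Iic] with y hy
    have hy : y ≤ t := hy
    have hp := hpos (t - y)
    by_cases hyM : y ∈ Icc (t - M) t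
    · rw [indicator_of_mem hyM, Real.norm_eq_abs, abs_le]
      have a1 : μ.real (Ioi ((t - y) / u)) ≤ 1 := measureReal_le_one
      have a2 : μ.real (Ioi (t - y)) ≤ 1 := measureReal_le_one
      have a3 : 0 ≤ μ.real (Ioi ((t - y) / u)) := measureReal_nonneg
      have a4 : u ^ α * μ.real (Ioi (t - y)) ≤ 1 := mul_le_one₀ huα hp.le a2
      have a5 := mul_pos huα0 hp
      have a6 := mul_pos (half_pos hε) hp
      constructor <;> linarith
    · rw [indicator_of_notMem hyM, add_zero]
      have hlarge : M' ≤ t - y := by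
        by_contra hcon
        exact hyM ⟨by linarith [le_max_left M' 0], hy⟩
      have := hM' _ hlarge
      rw [Real.dist_eq] at this
      have e4 : μ.real (Ioi ((t - y) / u)) - u ^ α * μ.real (Ioi (t - y))
          = (μ.real (Ioi (u⁻¹ * (t - y))) / μ.real (Ioi (t - y)) - u ^ α)
            * μ.real (Ioi (t - y)) := by
        rw [div_eq_inv_mul (t - y) u]; field_simp
      rw [e4, Real.norm_eq_abs, abs_mul, abs_of_pos hp]
      gcongr
  refine hbound.trans_lt ?_
  rw [integral_add (hi1.const_mul _) hi3, integral_const_mul, e2,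
    integral_indicator measurableSet_Icc,
    Measure.restrict_restrict measurableSet_Icc, inter_eq_left.2 Icc_subset_Iic_self]
  simp only [setIntegral_const, smul_eq_mul, mul_one]
  linarith

/-! ### The renewal process -/

/-- The inter-arrival times are independent, identically distributed and non-negative. -/
structure IsRenewalProcess {Ω : Type*} [MeasurableSpace Ω] (P : Measure Ω) (X : ℕ → Ω → ℝ) :
    Prop where
  aemeasurable : ∀ n, AEMeasurable (X n) P
  iIndepFun : iIndepFun X P
  map_eq : ∀ n, P.map (X n) = P.map (X 0)
  nonneg : ∀ n, ∀ᵐ ω ∂P, 0 ≤ X n ω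

section Epoch

variable {Ω : Type*} {X : ℕ → Ω → ℝ}

lemma epoch_zero (ω : Ω) : epoch X 0 ω = 0 := by simp [epoch]

lemma epoch_succ (n : ℕ) (ω : Ω) : epoch X (n + 1) ω = epoch X n ω + X n ω := by
  simp [epoch, Finset.sum_range_succ]

lemma age_div_cycle (t : ℝ) (ω : Ω) : age X t ω / cycle X t ω
    = (t - epoch X (count X t ω) ω) / X (count X t ω) ω := by
  have : cycle X t ω = X (count X t ω) ω := by
    rw [cycle, residual, age, epoch_succ]; ring
  rw [this, age]

end Epoch

variable {Ω : Type*} [MeasurableSpace Ω] {P : Measure Ω} {X : ℕ → Ω → ℝ}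

/-- The renewal measure `∑ n, law (S n)`. -/
noncomputable def renewalMeasure (P : Measure Ω) (X : ℕ → Ω → ℝ) : Measure ℝ :=
  Measure.sum fun n ↦ P.map (epoch X n)

instance [IsProbabilityMeasure P] : SFinite (renewalMeasure P X) := by
  unfold renewalMeasure; infer_instance

/-- The pairs `(y, x)` such that a cycle of length `x` that starts at time `y` is in progress at
time `t`, and the age at time `t` is a fraction in `s` of its length. -/
def cycleSet (t : ℝ) (s : Set ℝ) : Set (ℝ × ℝ) :=
  {p | p.1 ≤ t ∧ t < p.1 + p.2 ∧ (t - p.1) / p.2 ∈ s}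

lemma measurableSet_cycleSet (t : ℝ) {s : Set ℝ} (hs : MeasurableSet s) :
    MeasurableSet (cycleSet t s) := by
  have h : Measurable fun p : ℝ × ℝ ↦ (t - p.1) / p.2 := by fun_prop
  exact (measurableSet_le measurable_fst measurable_const).inter
    ((measurableSet_lt measurable_const (measurable_fst.add measurable_snd)).inter (h hs))

namespace IsRenewalProcess

lemma aemeasurable_epoch (h : IsRenewalProcess P X) (n : ℕ) : AEMeasurable (epoch X n) P :=
  Finset.aemeasurable_fun_sum _ fun i _ ↦ h.aemeasurable i

lemma aemeasurable_prodMk (h : IsRenewalProcess P X) (n : ℕ) :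
    AEMeasurable (fun ω ↦ (epoch X n ω, X n ω)) P :=
  (h.aemeasurable_epoch n).prodMk (h.aemeasurable n)

lemma ae_monotone_epoch (h : IsRenewalProcess P X) :
    ∀ᵐ ω ∂P, Monotone fun n ↦ epoch X n ω := by
  filter_upwards [ae_all_iff.2 h.nonneg] with ω hω
  refine monotone_nat_of_le_succ fun n ↦ ?_
  rw [epoch_succ]
  linarith [hω n]

lemma ae_epoch_nonneg (h : IsRenewalProcess P X) : ∀ᵐ ω ∂P, ∀ n, 0 ≤ epoch X n ω := by
  filter_upwards [h.ae_monotone_epoch] with ω hω n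
  simpa [epoch_zero] using hω (Nat.zero_le n)

lemma map_prodMk [IsProbabilityMeasure P] (h : IsRenewalProcess P X) (n : ℕ) :
    P.map (fun ω ↦ (epoch X n ω, X n ω)) = (P.map (epoch X n)).prod (P.map (X 0)) := by
  have h1 : epoch X n = ∑ i ∈ Finset.range n, X i := by ext; simp [epoch]
  have hi : IndepFun (epoch X n) (X n) P := h1 ▸
    h.iIndepFun.indepFun_finsetSum_of_notMem₀ h.aemeasurable (by simp : n ∉ Finset.range n)
  rw [← h.map_eq n]
  exact (indepFun_iff_map_prod_eq_prod_map_map (h.aemeasurable_epoch n) (h.aemeasurable n)).1 hi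

/-- `S n` and the length `X n` of the cycle that it begins are independent. -/
lemma tsum_measure_prodMk [IsProbabilityMeasure P] (h : IsRenewalProcess P X)
    {E : Set (ℝ × ℝ)} (hE : MeasurableSet E) :
    ∑' n, P {ω | (epoch X n ω, X n ω) ∈ E}
      = ∫⁻ y, P.map (X 0) (Prod.mk y ⁻¹' E) ∂(renewalMeasure P X) := by
  have := Measure.isProbabilityMeasure_map (h.aemeasurable 0)
  rw [← Measure.prod_apply hE, renewalMeasure, Measure.prod_sum_left, Measure.sum_apply _ hE]
  refine tsum_congr fun n ↦ ?_
  rw [← h.map_prodMk n, Measure.map_apply_of_aemeasurable (h.aemeasurable_prodMk n) hE]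
  rfl

lemma nullMeasurableSet_cycleSet (h : IsRenewalProcess P X) (t : ℝ) {s : Set ℝ}
    (hs : MeasurableSet s) (n : ℕ) :
    NullMeasurableSet {ω | (epoch X n ω, X n ω) ∈ cycleSet t s} P :=
  (h.aemeasurable_prodMk n).nullMeasurable (measurableSet_cycleSet t hs)

lemma pairwise_aedisjoint (h : IsRenewalProcess P X) (t : ℝ) (s : Set ℝ) :
    Pairwise (Function.onFun (AEDisjoint P)
      fun n ↦ {ω | (epoch X n ω, X n ω) ∈ cycleSet t s}) := by
  have key : ∀ i j, i < j → AEDisjoint P {ω | (epoch X i ω, X i ω) ∈ cycleSet t s}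
      {ω | (epoch X j ω, X j ω) ∈ cycleSet t s} := fun i j hij ↦ by
    refine measure_eq_zero_iff_ae_notMem.2 ?_
    filter_upwards [h.ae_monotone_epoch] with ω hω
    rintro ⟨⟨-, hi, -⟩, hj, -, -⟩
    have : epoch X (i + 1) ω ≤ epoch X j ω := hω hij
    rw [epoch_succ] at this
    dsimp at hi hj
    linarith
  intro i j hij
  rcases lt_or_gt_of_ne hij with h1 | h1
  · exact key i j h1
  · exact (key j i h1).symm

lemma measure_iUnion_cycleSet [IsProbabilityMeasure P] (h : IsRenewalProcess P X) (t : ℝ)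
    {s : Set ℝ} (hs : MeasurableSet s) :
    P (⋃ n, {ω | (epoch X n ω, X n ω) ∈ cycleSet t s})
      = ∫⁻ y, P.map (X 0) (Prod.mk y ⁻¹' cycleSet t s) ∂(renewalMeasure P X) := by
  rw [measure_iUnion₀ (h.pairwise_aedisjoint t s) (h.nullMeasurableSet_cycleSet t hs),
    h.tsum_measure_prodMk (measurableSet_cycleSet t hs)]

lemma lintegral_cycleSet_univ (t : ℝ) (μ ν : Measure ℝ) :
    ∫⁻ y, μ (Prod.mk y ⁻¹' cycleSet t univ) ∂ν = ∫⁻ y in Iic t, μ (Ioi (t - y)) ∂ν := by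
  rw [← lintegral_indicator measurableSet_Iic]
  refine lintegral_congr fun y ↦ ?_
  by_cases hy : y ≤ t
  · rw [indicator_of_mem (by exact hy)]
    congr 1; ext x; simp [cycleSet, hy, sub_lt_iff_lt_add']
  · rw [indicator_of_notMem (by exact hy)]
    convert measure_empty (μ := μ); ext x; simp [cycleSet, hy]

/-- For `0 < u < 1`, a cycle that starts at `y ≤ t` is in progress at time `t` with its age less
than a fraction `u` of its length if and only if it is longer than `(t - y) / u`. -/
lemma lintegral_cycleSet_Iio (t : ℝ) {u : ℝ} (hu : u ∈ Ioo (0 : ℝ) 1) (μ ν : Measure ℝ) :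
    ∫⁻ y, μ (Prod.mk y ⁻¹' cycleSet t (Iio u)) ∂ν
      = ∫⁻ y in Iic t, μ (Ioi ((t - y) / u)) ∂ν := by
  rw [← lintegral_indicator measurableSet_Iic]
  refine lintegral_congr fun y ↦ ?_
  by_cases hy : y ≤ t
  · rw [indicator_of_mem (by exact hy)]
    congr 1; ext x
    have h0 : 0 ≤ t - y := by linarith
    simp only [cycleSet, mem_preimage, mem_ofPred_eq, mem_Iio, mem_Ioi]
    constructor
    · rintro ⟨-, h1, h2⟩
      rw [div_lt_iff₀ (by linarith)] at h2
      rwa [div_lt_iff₀ hu.1, mul_comm]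
    · intro h1
      have h2 := le_div_self h0 hu.1 hu.2.le
      refine ⟨hy, by linarith, ?_⟩
      rw [div_lt_iff₀ (by linarith)]
      rwa [div_lt_iff₀ hu.1, mul_comm] at h1
  · rw [indicator_of_notMem (by exact hy)]
    convert measure_empty (μ := μ); ext x; simp [cycleSet, hy]

lemma isRenewalMeasure [IsProbabilityMeasure P] (h : IsRenewalProcess P X) :
    IsRenewalMeasure (P.map (X 0)) (renewalMeasure P X) where
  lintegral_tail_le_one t := by
    rw [← lintegral_cycleSet_univ, ← h.measure_iUnion_cycleSet t MeasurableSet.univ]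
    exact prob_le_one
  apply_eq_lintegral B hB h0 := by
    have := Measure.isProbabilityMeasure_map (h.aemeasurable 0)
    have hE : MeasurableSet {p : ℝ × ℝ | p.1 + p.2 ∈ B} :=
      (measurable_fst.add measurable_snd) hB
    have h1 : ∫⁻ x, renewalMeasure P X {y | y + x ∈ B} ∂(P.map (X 0))
        = ∑' n, P {ω | epoch X (n + 1) ω ∈ B} := by
      calc _ = ((renewalMeasure P X).prod (P.map (X 0))) {p : ℝ × ℝ | p.1 + p.2 ∈ B} :=
            (Measure.prod_apply_symm hE).symm
        _ = ∑' n, P {ω | (epoch X n ω, X n ω) ∈ {p : ℝ × ℝ | p.1 + p.2 ∈ B}} := by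
            rw [h.tsum_measure_prodMk hE, Measure.prod_apply hE]
        _ = _ := by simp only [epoch_succ, mem_ofPred_eq]
    have h2 : renewalMeasure P X B = ∑' n, P {ω | epoch X n ω ∈ B} := by
      rw [renewalMeasure, Measure.sum_apply _ hB]
      exact tsum_congr fun n ↦ Measure.map_apply_of_aemeasurable (h.aemeasurable_epoch n) hB
    rw [h1, h2, tsum_eq_zero_add' ENNReal.summable]
    simp [epoch_zero, h0]

/-- The expected number of renewals up to time `t` is finite, hence so is almost surely their
number. -/
lemma ae_bddAbove_epoch_le [IsProbabilityMeasure P] (h : IsRenewalProcess P X)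
    (hpos : ∀ t, 0 < (P.map (X 0)).real (Ioi t)) (t : ℝ) :
    ∀ᵐ ω ∂P, BddAbove {n : ℕ | epoch X n ω ≤ t} := by
  have := Measure.isProbabilityMeasure_map (h.aemeasurable 0)
  have hfin := h.isRenewalMeasure.measure_Icc_ne_top hpos t t
  rw [renewalMeasure, Measure.sum_apply _ measurableSet_Icc] at hfin
  have heq : ∀ n, P.map (epoch X n) (Icc (t - t) t) = P {ω | epoch X n ω ≤ t} := fun n ↦ by
    rw [Measure.map_apply_of_aemeasurable (h.aemeasurable_epoch n) measurableSet_Icc]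
    refine measure_congr ?_
    filter_upwards [h.ae_epoch_nonneg] with ω hω
    exact propext ⟨fun h ↦ h.2, fun h ↦ ⟨by simpa using hω n, h⟩⟩
  simp_rw [heq] at hfin
  filter_upwards [ae_eventually_notMem hfin] with ω hω
  obtain ⟨N, hN⟩ := eventually_atTop.1 hω
  refine ⟨N, fun n hn ↦ ?_⟩
  by_contra hcon
  exact hN n (not_le.1 hcon).le hn

/-- Almost surely `N t` is the only `n` with `S n ≤ t < S (n + 1)`. -/
lemma ae_mem_cycleSet_iff [IsProbabilityMeasure P] (h : IsRenewalProcess P X)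
    (hpos : ∀ t, 0 < (P.map (X 0)).real (Ioi t)) {t : ℝ} (ht : 0 ≤ t) (s : Set ℝ) :
    ∀ᵐ ω ∂P, (∃ n, (epoch X n ω, X n ω) ∈ cycleSet t s) ↔ age X t ω / cycle X t ω ∈ s := by
  filter_upwards [h.ae_bddAbove_epoch_le hpos t, h.ae_monotone_epoch] with ω hb hm
  have hmem : epoch X (count X t ω) ω ≤ t :=
    Nat.sSup_mem (s := {n : ℕ | epoch X n ω ≤ t}) ⟨0, by simpa [epoch_zero] using ht⟩ hb
  have hlt : t < epoch X (count X t ω) ω + X (count X t ω) ω := by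
    rw [← epoch_succ]
    by_contra hcon
    have : count X t ω + 1 ≤ count X t ω := le_csSup hb (not_lt.1 hcon)
    omega
  rw [age_div_cycle]
  constructor
  · rintro ⟨n, h1, h2, h3⟩
    have hn : n = count X t ω := by
      refine le_antisymm (le_csSup hb h1) (not_lt.1 fun hcon ↦ ?_)
      have : epoch X (n + 1) ω ≤ epoch X (count X t ω) ω := hm hcon
      rw [epoch_succ] at this
      dsimp at h2
      linarith
    exact hn ▸ h3
  · exact fun h ↦ ⟨_, hmem, hlt, h⟩

lemma preimage_age_div_cycle_ae_eq [IsProbabilityMeasure P] (h : IsRenewalProcess P X)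
    (hpos : ∀ t, 0 < (P.map (X 0)).real (Ioi t)) {t : ℝ} (ht : 0 ≤ t) (s : Set ℝ) :
    (fun ω ↦ age X t ω / cycle X t ω) ⁻¹' s
      =ᵐ[P] ⋃ n, {ω | (epoch X n ω, X n ω) ∈ cycleSet t s} := by
  filter_upwards [h.ae_mem_cycleSet_iff hpos ht s] with ω hω
  refine propext (Iff.trans hω.symm ?_)
  change _ ↔ ω ∈ ⋃ n, {ω | (epoch X n ω, X n ω) ∈ cycleSet t s}
  rw [mem_iUnion]
  rfl

lemma measure_age_div_cycle_mem [IsProbabilityMeasure P] (h : IsRenewalProcess P X)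
    (hpos : ∀ t, 0 < (P.map (X 0)).real (Ioi t)) {t : ℝ} (ht : 0 ≤ t) {s : Set ℝ}
    (hs : MeasurableSet s) :
    P ((fun ω ↦ age X t ω / cycle X t ω) ⁻¹' s)
      = ∫⁻ y, P.map (X 0) (Prod.mk y ⁻¹' cycleSet t s) ∂(renewalMeasure P X) := by
  rw [measure_congr (h.preimage_age_div_cycle_ae_eq hpos ht s), h.measure_iUnion_cycleSet t hs]

lemma aemeasurable_age_div_cycle [IsProbabilityMeasure P] (h : IsRenewalProcess P X)
    (hpos : ∀ t, 0 < (P.map (X 0)).real (Ioi t)) (t : ℝ) :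
    AEMeasurable (fun ω ↦ age X t ω / cycle X t ω) P := by
  rcases le_or_gt 0 t with ht | ht
  · refine NullMeasurable.aemeasurable fun s hs ↦ ?_
    exact (NullMeasurableSet.iUnion fun n ↦ h.nullMeasurableSet_cycleSet t hs n).congr
      (h.preimage_age_div_cycle_ae_eq hpos ht s).symm
  · -- at negative times no epoch is counted, so that `count` is `sSup ∅ = 0`
    refine (((h.aemeasurable_epoch 0).const_sub t).div (h.aemeasurable 0)).congr ?_
    filter_upwards [h.ae_epoch_nonneg] with ω hω
    have : count X t ω = 0 := by
      have : {n : ℕ | epoch X n ω ≤ t} = ∅ := by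
        ext n; simpa using ht.trans_le (hω n)
      rw [count, this]; exact csSup_empty
    rw [age_div_cycle, this]
    rfl

/-- At a non-negative time the ratio of age to cycle length is almost surely in `[0, 1)`. -/
lemma ae_age_div_cycle_mem_Ico [IsProbabilityMeasure P] (h : IsRenewalProcess P X)
    (hpos : ∀ t, 0 < (P.map (X 0)).real (Ioi t)) {t : ℝ} (ht : 0 ≤ t) :
    ∀ᵐ ω ∂P, age X t ω / cycle X t ω ∈ Ico (0 : ℝ) 1 := by
  filter_upwards [h.ae_mem_cycleSet_iff hpos ht univ, h.ae_mem_cycleSet_iff hpos ht (Ico 0 1)]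
    with ω h1 h2
  obtain ⟨n, hn1, hn2, -⟩ := h1.2 trivial
  refine h2.1 ⟨n, hn1, hn2, ?_⟩
  dsimp at hn1 hn2 ⊢
  have : 0 < X n ω := by linarith
  exact ⟨div_nonneg (by linarith) this.le, (div_lt_one this).2 (by linarith)⟩

end IsRenewalProcess

/-! ### Convergence in distribution -/

/-- Weak convergence on the line follows from convergence of the left-continuous distribution
functions at every point. -/
lemma tendsto_probabilityMeasure_of_tendsto_Iio {ι : Type*} {l : Filter ι}
    [l.IsCountablyGenerated] {μ : ι → ProbabilityMeasure ℝ} {ν : ProbabilityMeasure ℝ}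
    (h : ∀ u, Tendsto (fun i ↦ (μ i : Measure ℝ).real (Iio u)) l
      (𝓝 ((ν : Measure ℝ).real (Iio u)))) :
    Tendsto μ l (𝓝 ν) := by
  have hIco : ∀ (m : ProbabilityMeasure ℝ) {a b : ℝ}, a < b →
      (m : Measure ℝ).real (Ico a b)
        = (m : Measure ℝ).real (Iio b) - (m : Measure ℝ).real (Iio a) :=
    fun m a b hab ↦ by
      rw [← measureReal_sdiff (Iio_subset_Iio hab.le) measurableSet_Iio]
      congr 1; ext x; simp
  refine IsPiSystem.tendsto_probabilityMeasure_of_tendsto_of_mem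
    (S := {s | ∃ a b : ℝ, a < b ∧ Ico a b = s}) ?_ ?_ ?_ ?_
  · simpa using isPiSystem_Ico_mem (univ : Set ℝ) univ
  · rintro _ ⟨a, b, -, rfl⟩; exact measurableSet_Ico
  · intro U hU x hx
    obtain ⟨a, b, hab, hsub⟩ := mem_nhds_iff_exists_Ioo_subset.1 (hU.mem_nhds hx)
    obtain ⟨c, hac, hcx⟩ := exists_between hab.1
    exact ⟨Ico c b, ⟨c, b, hcx.trans hab.2, rfl⟩, Ico_mem_nhds hcx hab.2,
      fun y hy ↦ hsub ⟨hac.trans_le hy.1, hy.2⟩⟩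
  · rintro _ ⟨a, b, hab, rfl⟩
    rw [← NNReal.tendsto_coe]
    have := (h b).sub (h a)
    simp_rw [← hIco _ hab] at this
    exact this

lemma measureReal_preimage_Iio_of_nonpos {Ω : Type*} [MeasurableSpace Ω] {P : Measure Ω}
    {Y : Ω → ℝ} (hY : ∀ᵐ ω ∂P, Y ω ∈ Ico (0 : ℝ) 1) {u : ℝ} (hu : u ≤ 0) :
    P.real (Y ⁻¹' Iio u) = 0 := by
  rw [measureReal_def, measure_eq_zero_iff_ae_notMem.2, ENNReal.toReal_zero]
  filter_upwards [hY] with ω hω h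
  exact absurd (hω.1.trans_lt h) hu.not_gt

lemma measureReal_preimage_Iio_of_one_le {Ω : Type*} [MeasurableSpace Ω] {P : Measure Ω}
    [IsProbabilityMeasure P] {Y : Ω → ℝ} (hY : ∀ᵐ ω ∂P, Y ω ∈ Ico (0 : ℝ) 1) {u : ℝ}
    (hu : 1 ≤ u) : P.real (Y ⁻¹' Iio u) = 1 := by
  have h : Y ⁻¹' Iio u =ᵐ[P] univ := eventuallyEq_univ.2 <| by
    filter_upwards [hY] with ω hω using hω.2.trans_le hu
  rw [measureReal_def, measure_congr h, measure_univ, ENNReal.toReal_one]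

section Uniform

variable {Ω : Type*} [MeasurableSpace Ω] {P : Measure Ω} {U : Ω → ℝ} {α : ℝ}

lemma ae_mem_Ioo_of_isUniform (hU : pdf.IsUniform U (Ioo (0 : ℝ) 1) P volume) :
    ∀ᵐ ω ∂P, U ω ∈ Ioo (0 : ℝ) 1 := by
  have h : P (U ⁻¹' (Ioo 0 1)ᶜ) = 0 := by
    rw [hU.measure_preimage (by simp) (by simp) measurableSet_Ioo.compl, inter_compl_self]
    simp
  filter_upwards [measure_eq_zero_iff_ae_notMem.1 h] with ω hω using not_not.1 hω

lemma ae_rpow_mem_Ico_of_isUniform (hU : pdf.IsUniform U (Ioo (0 : ℝ) 1) P volume) (hα : 0 < α) :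
    ∀ᵐ ω ∂P, U ω ^ (1 / α) ∈ Ico (0 : ℝ) 1 := by
  filter_upwards [ae_mem_Ioo_of_isUniform hU] with ω hω
  exact ⟨Real.rpow_nonneg hω.1.le _, Real.rpow_lt_one hω.1.le hω.2 (by positivity)⟩

lemma measureReal_rpow_lt_of_isUniform (hU : pdf.IsUniform U (Ioo (0 : ℝ) 1) P volume)
    (hα : 0 < α) {u : ℝ} (hu : u ∈ Ioo (0 : ℝ) 1) :
    P.real ((fun ω ↦ U ω ^ (1 / α)) ⁻¹' Iio u) = u ^ α := by
  have huα : u ^ α < 1 := Real.rpow_lt_one hu.1.le hu.2 hα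
  have heq : P ((fun ω ↦ U ω ^ (1 / α)) ⁻¹' Iio u) = P (U ⁻¹' Iio (u ^ α)) := by
    refine measure_congr ?_
    filter_upwards [ae_mem_Ioo_of_isUniform hU] with ω hω
    refine propext ?_
    change U ω ^ (1 / α) < u ↔ U ω < u ^ α
    rw [one_div, Real.rpow_inv_lt_iff_of_pos hω.1.le hu.1.le hα]
  rw [measureReal_def, heq, hU.measure_preimage (by simp) (by simp) measurableSet_Iio,
    Ioo_inter_Iio, min_eq_right huα.le]
  simp [Real.rpow_nonneg hu.1.le]

end Uniform

end Renewal

theorem mainTheorem1 {Ω Ω' : Type*} [MeasurableSpace Ω] [MeasurableSpace Ω']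
    (P : Measure Ω) [IsProbabilityMeasure P] (P' : Measure Ω') [IsProbabilityMeasure P']
    (X : ℕ → Ω → ℝ)
    (hindep : iIndepFun X P)
    (hident : ∀ n, IdentDistrib (X n) (X 0) P P)
    (hnonneg : ∀ n, ∀ᵐ ω ∂P, 0 ≤ X n ω)
    (hnonarith : ¬ Renewal.IsArithmetic (P.map (X 0)))
    (α : ℝ) (hα : α ∈ Ioo (0 : ℝ) 1)
    (L : ℝ → ℝ) (hL : Renewal.IsSlowlyVarying L)
    (t₀ : ℝ) (ht₀ : 0 < t₀)
    (htail : ∀ t : ℝ, t₀ < t →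
      IntegrableOn (fun s : ℝ => s ^ (-α - 1) * L s) (Ioi t) volume ∧
      P.real {ω | t < X 0 ω} = ∫ s in Ioi t, s ^ (-α - 1) * L s)
    (U : Ω' → ℝ) (hU : pdf.IsUniform U (Ioo (0 : ℝ) 1) P' volume) :
    TendstoInDistribution
      (fun (t : ℝ) (ω : Ω) => Renewal.age X t ω / Renewal.cycle X t ω) atTop
      (fun ω' : Ω' => U ω' ^ (1 / α)) (fun _ => P) P' := by
  have h : Renewal.IsRenewalProcess P X :=
    ⟨fun n ↦ (hident n).aemeasurable_fst, hindep, fun n ↦ (hident n).map_eq, hnonneg⟩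
  set μ := P.map (X 0) with hμ
  have : IsProbabilityMeasure μ := Measure.isProbabilityMeasure_map (h.aemeasurable 0)
  have htail' : ∀ t : ℝ, t₀ < t →
      IntegrableOn (fun s : ℝ ↦ s ^ (-α - 1) * L s) (Ioi t) volume ∧
      μ.real (Ioi t) = ∫ s in Ioi t, s ^ (-α - 1) * L s := fun t ht ↦ by
    refine ⟨(htail t ht).1, ?_⟩
    rw [← (htail t ht).2, hμ,
      map_measureReal_apply_of_aemeasurable (h.aemeasurable 0) measurableSet_Ioi]
    rfl
  have hpos := Renewal.tail_pos hL htail'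
  have hUm : AEMeasurable U P' := hU.aemeasurable (by simp) (by simp)
  have hren := h.isRenewalMeasure
  have hvan := hren.tendsto_measure_Icc hpos (Renewal.lintegral_tail_eq_top hα.2 hL htail')
    (Renewal.exists_restrict_Ioi_absolutelyContinuous hL htail')
  have hone : ∀ t, 0 ≤ t →
      ∫⁻ y in Iic t, μ (Ioi (t - y)) ∂(Renewal.renewalMeasure P X) = 1 := fun t ht ↦ by
    rw [← Renewal.IsRenewalProcess.lintegral_cycleSet_univ,
      ← h.measure_age_div_cycle_mem hpos ht MeasurableSet.univ, preimage_univ, measure_univ]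
  refine ⟨h.aemeasurable_age_div_cycle hpos, hUm.pow_const _,
    Renewal.tendsto_probabilityMeasure_of_tendsto_Iio fun u ↦ ?_⟩
  have hleft : ∀ t, (P.map fun ω ↦ Renewal.age X t ω / Renewal.cycle X t ω).real (Iio u)
      = P.real ((fun ω ↦ Renewal.age X t ω / Renewal.cycle X t ω) ⁻¹' Iio u) := fun t ↦
    map_measureReal_apply_of_aemeasurable (h.aemeasurable_age_div_cycle hpos t) measurableSet_Iio
  have hright : (P'.map fun ω' ↦ U ω' ^ (1 / α)).real (Iio u)
      = P'.real ((fun ω' ↦ U ω' ^ (1 / α)) ⁻¹' Iio u) :=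
    map_measureReal_apply_of_aemeasurable (hUm.pow_const _) measurableSet_Iio
  change Tendsto (fun t : ℝ ↦ (P.map fun ω ↦ Renewal.age X t ω / Renewal.cycle X t ω).real (Iio u))
    atTop (𝓝 ((P'.map fun ω' ↦ U ω' ^ (1 / α)).real (Iio u)))
  simp_rw [hleft, hright]
  have hU01 := Renewal.ae_rpow_mem_Ico_of_isUniform hU hα.1
  rcases le_or_gt u 0 with hu0 | hu0
  · rw [Renewal.measureReal_preimage_Iio_of_nonpos hU01 hu0]
    refine tendsto_const_nhds.congr' ?_
    filter_upwards [eventually_ge_atTop 0] with t ht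
    exact (Renewal.measureReal_preimage_Iio_of_nonpos
      (h.ae_age_div_cycle_mem_Ico hpos ht) hu0).symm
  rcases le_or_gt 1 u with hu1 | hu1
  · rw [Renewal.measureReal_preimage_Iio_of_one_le hU01 hu1]
    refine tendsto_const_nhds.congr' ?_
    filter_upwards [eventually_ge_atTop 0] with t ht
    exact (Renewal.measureReal_preimage_Iio_of_one_le
      (h.ae_age_div_cycle_mem_Ico hpos ht) hu1).symm
  have hu : u ∈ Ioo (0 : ℝ) 1 := ⟨hu0, hu1⟩
  have hreg := Renewal.tendsto_tail_ratio hL htail' (inv_pos.2 hu0)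
  rw [Real.inv_rpow hu0.le, Real.rpow_neg hu0.le, inv_inv] at hreg
  rw [Renewal.measureReal_rpow_lt_of_isUniform hU hα.1 hu]
  refine (hren.tendsto_lintegral_tail_div hpos hone hvan hu hα.1.le hreg).congr' ?_
  filter_upwards [eventually_ge_atTop 0] with t ht
  rw [measureReal_def, h.measure_age_div_cycle_mem hpos ht measurableSet_Iio,
    Renewal.IsRenewalProcess.lintegral_cycleSet_Iio t hu]
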